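/- Throughout, $S^3=\{(z_1,z_2)\in\mathbb C^2 : |z_1|^2+|z_2|^2=1\}$ and a knot is a simple closed curve in $S^3$. Let $q\ge 3$. A knot $K$ is *$q$-periodic* if there is a homeomorphism $\Phi$ of $S^3$ of period $q$ with $\Phi(K)=K$ that is topologically conjugate to the rotation $(z_1,z_2)\mapsto(e^{2\pi i/q}z_1,z_2)$ and whose axis (the circle of fixed points) is disjoint from $K$. It is *freely $q$-periodic* if there is a homeomorphism $\Phi$ of $S^3$ of period $q$ with $\Phi(K)=K$ such that $\Phi^i$ has no fixed point for $1\le i\le q-1$. A *tangle* has two strings, with end points NW, SW on its left side and NE, SE on its right side; it is regarded up to isotopy of its diagram in the projection disk fixing the boundary. The tangle sum $TT'$ places $T'$ to the right of $T$ and joins NE, SE of $T$ to NW, SW of $T'$. The closure of a tangle joins its right end points to its left end points by two disjoint arcs on the projection sphere, without new crossings. $\sigma$ is the tangle of the generator of the 2-strand braid group (one crossing of two horizontal strands), and $\sigma^n$, $n\in\mathbb Z$, are its powers. Let $F$ be the rotation by $\pi$ about the horizontal axis in the projection plane that exchanges NW with SW and NE with SE. A *flype* replaces a subtangle of the form $\sigma^{\pm1}S$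 (in some coordinates on a disk of the diagram), with $S$ a tangle, by $F(S)\,\sigma^{\pm1}$, with the same sign. Two tangles with the same end points are *flype-equivalent* if they are connected by a finite sequence of flypes and inverse flypes on subtangles. A tangle $T$ is *symmetric* if $T$ is flype-equivalent to $F(T)$. **Proposition.** Let $q\ge 3$ be odd, let $T$ be a symmetric tangle, let $i_1,\dots,i_q\in\mathbb Z$, and let $K\subset S^3$ be a knot that is equivalent, by a homeomorphism of $S^3$, to the closure of $$\sigma^{i_1}\,T\,\sigma^{i_2}\,T\cdots\sigma^{i_q}\,T .$$ Let $w=i_1+\dots+i_q$ be its visible weight. 1. If $w$ is a multiple of $q$, then $K$ is $q$-periodic. 2. If $\gcd(w,q)=1$, then $K$ is freely $q$-periodic. -/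

import Mathlib

open Set

namespace KnotPeriod

noncomputable section

/-! The 3-sphere, knots, and their periodic symmetries. -/

/-- The 3-sphere `{(z₁, z₂) ∈ ℂ × ℂ : |z₁|² + |z₂|² = 1}`. -/
abbrev S3 : Type := {p : ℂ × ℂ // ‖p.1‖ ^ 2 + ‖p.2‖ ^ 2 = 1}

/-- A knot: a simple closed curve in `S³`. -/
def IsKnot (K : Set S3) : Prop :=
  ∃ f : Circle → S3, Continuous f ∧ Function.Injective f ∧ range f = K

/-- `K` is `q`-periodic: some homeomorphism of pairs `Φ` of `(S³, K)`, of period `q`, is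
topologically conjugate (by `c`) to the rotation `(z₁, z₂) ↦ (e^{2πi/q} z₁, z₂)` of `S³`, and
the axis of `Φ`, which is the preimage by `c` of the circle `z₁ = 0`, is disjoint from `K`. -/
def IsPeriodic (q : ℕ) (K : Set S3) : Prop :=
  ∃ Φ : S3 ≃ₜ S3, Φ '' K = K ∧ orderOf Φ = q ∧
    ∃ c : S3 ≃ₜ S3,
      (∀ p : S3, (c (Φ p)).1 =
        (Complex.exp (2 * Real.pi * Complex.I / q) * (c p).1.1, (c p).1.2)) ∧
      ∀ p ∈ K, (c p).1.1 ≠ 0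

/-- `K` is freely `q`-periodic: there is a homeomorphism of pairs `Φ` of `(S³, K)`, of period
`q`, such that `Φ ^ i` has no fixed point for `1 ≤ i ≤ q - 1`. -/
def IsFreelyPeriodic (q : ℕ) (K : Set S3) : Prop :=
  ∃ Φ : S3 ≃ₜ S3, Φ '' K = K ∧ orderOf Φ = q ∧
    ∀ i : ℕ, 1 ≤ i → i < q → ∀ p : S3, (Φ ^ i) p ≠ p

/-! Tangles. Coordinates on 3-space are `(x, v) ∈ ℝ × ℂ` with `v = y + i z`: the `x`-axis points
to the east, the `y`-axis to the north, and `z` is the height above the projection plane `z = 0`.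
A tangle diagram is recorded by a spatial tangle of which it is the projection along the
`z`-axis. -/

/-- The solid cylinder `[0, 1] × D`, with `D` the closed unit disk of `ℂ`. -/
def cylinder : Set (ℝ × ℂ) := Icc (0 : ℝ) 1 ×ˢ Metric.closedBall (0 : ℂ) 1

/-- The projection to the plane: `(x, y, z) ↦ (x, y)`. -/
def planeProj (p : ℝ × ℂ) : ℝ × ℝ := (p.1, p.2.re)

/-- The height `(x, y, z) ↦ z`. -/
def height (p : ℝ × ℂ) : ℝ := p.2.im

/-- The disk `[0, 1] × [-1, 1]` of the projection plane, which is the projection of `cylinder`. -/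
def planeDisk : Set (ℝ × ℝ) := Icc (0 : ℝ) 1 ×ˢ Icc (-1 : ℝ) 1

/-- A tangle with two strings: a union of two disjoint simple arcs properly embedded in
`[0, 1] × D`, disjoint from `[0, 1] × ∂D`, with the four end points `(0, ±1/2)` (north-west and
south-west) and `(1, ±1/2)` (north-east and south-east), and equal to the straight
strands `v = ±1/2` near the two end disks. -/
def IsTangle (T : Set (ℝ × ℂ)) : Prop :=
  T ⊆ Icc (0 : ℝ) 1 ×ˢ Metric.ball (0 : ℂ) 1 ∧
  (∃ γ : Fin 2 → unitInterval → ℝ × ℂ,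
    (∀ k, Continuous (γ k)) ∧
    Function.Injective (fun a : Fin 2 × unitInterval => γ a.1 a.2) ∧
    T = ⋃ k, range (γ k) ∧
    ∀ k s, ((γ k s).1 = 0 ∨ (γ k s).1 = 1) ↔ (s = 0 ∨ s = 1)) ∧
  ∃ δ : ℝ, 0 < δ ∧ ∀ p : ℝ × ℂ, p.1 ∈ Icc 0 δ ∪ Icc (1 - δ) 1 →
    (p ∈ T ↔ p.2 = 1 / 2 ∨ p.2 = -1 / 2)

/-- The sum `T₀ T₁ ⋯ Tₙ₋₁` of `n` tangles: from west to east, the `j`-th one is squeezed into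
`[j / n, (j + 1) / n] × D`; the eastern end points of each are the western end points of the
next one. -/
def tangleSum {n : ℕ} (T : Fin n → Set (ℝ × ℂ)) : Set (ℝ × ℂ) :=
  {p | ∃ j : Fin n, ∃ a ∈ T j, p = (((j : ℝ) + a.1) / n, a.2)}

/-- The function that is `0` on `(-∞, 1/3]`, `1` on `[2/3, ∞)` and affine between. -/
def ramp (x : ℝ) : ℝ := max 0 (min 1 (3 * x - 1))

/-- The tangle `σⁿ` of the 2-braid with `n` half twists: the two antipodal strands turn about the
`x`-axis by the total angle `nπ`. Its diagram is a row of `|n|` crossings, which are of the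
opposite kind for `n < 0`. -/
def braidPow (n : ℤ) : Set (ℝ × ℂ) :=
  {p | p.1 ∈ Icc (0 : ℝ) 1 ∧
    (p.2 = 1 / 2 * Complex.exp (Real.pi * n * ramp p.1 * Complex.I) ∨
     p.2 = -1 / 2 * Complex.exp (Real.pi * n * ramp p.1 * Complex.I))}

/-- The rigid rotation by the angle `π` about the `x`-axis, `(x, y, z) ↦ (x, -y, -z)`. The axis is
in the projection plane; NW is exchanged with SW and NE with SE. -/
def halfTurn (T : Set (ℝ × ℂ)) : Set (ℝ × ℂ) := (fun p : ℝ × ℂ => (p.1, -p.2)) '' T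

/-- `T₁` and `T₂` have the same diagram up to a homeomorphism `h` of the disk that fixes its
boundary: `h` is covered by a homeomorphism `H` of the cylinder fixing its boundary that carries
`T₁` to `T₂` and preserves the over/under information. -/
def SameDiagram (T₁ T₂ : Set (ℝ × ℂ)) : Prop :=
  ∃ (H : (ℝ × ℂ) ≃ₜ (ℝ × ℂ)) (h : (ℝ × ℝ) ≃ₜ (ℝ × ℝ)),
    (∀ p, p ∉ interior cylinder → H p = p) ∧
    (∀ u, u ∉ interior planeDisk → h u = u) ∧
    H '' T₁ = T₂ ∧
    (∀ p ∈ T₁, planeProj (H p) = h (planeProj p)) ∧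
    ∀ p ∈ T₁, ∀ p' ∈ T₁, planeProj p = planeProj p' →
      height p < height p' → height (H p) < height (H p')

/-- `T₂` is obtained from `T₁` by a flype. There are a disk `h(planeDisk)` in the diagram and
coordinates on it (covered by coordinates `H` in space that take vertical lines to vertical
lines, upwards) in which the part of `T₁` over this disk is `σ^ε S`, with one crossing `σ^ε`
and a tangle `S`. It is replaced by `S^F σ^ε`: the crossing moves to the other side of
`S`, which is turned to `S^F = halfTurn S`. Nothing changes elsewhere. -/
def Flype (T₁ T₂ : Set (ℝ × ℂ)) : Prop :=
  ∃ (H : (ℝ × ℂ) ≃ₜ (ℝ × ℂ)) (h : (ℝ × ℝ) ≃ₜ (ℝ × ℝ)) (S : Set (ℝ × ℂ)) (ε : ℤ),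
    (∀ p ∈ cylinder, planeProj (H p) = h (planeProj p)) ∧
    (∀ p ∈ cylinder, ∀ p' ∈ cylinder, planeProj p = planeProj p' →
      height p < height p' → height (H p) < height (H p')) ∧
    H '' cylinder ⊆ cylinder ∧
    (∀ p ∈ T₁, planeProj p ∈ h '' planeDisk → p ∈ H '' cylinder) ∧
    IsTangle S ∧ (ε = 1 ∨ ε = -1) ∧
    T₁ ∩ H '' cylinder = H '' tangleSum ![braidPow ε, S] ∧
    T₂ ∩ H '' cylinder = H '' tangleSum ![halfTurn S, braidPow ε] ∧
    T₁ \ H '' cylinder = T₂ \ H '' cylinder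

/-- Flype-equivalence of tangle diagrams: they are connected by a finite sequence of flypes on
subtangles and of homeomorphisms of the disk fixing its boundary. -/
def FlypeEquiv : Set (ℝ × ℂ) → Set (ℝ × ℂ) → Prop :=
  Relation.EqvGen fun T₁ T₂ => SameDiagram T₁ T₂ ∨ Flype T₁ T₂

/-- A tangle is symmetric if it is flype-equivalent to its image by the half turn. -/
def IsSymmetric (T : Set (ℝ × ℂ)) : Prop := FlypeEquiv T (halfTurn T)

/-- The closure in `S³` of a tangle, by the embedding
`(x, v) ↦ (√(1 - |v|²) e^{2πix}, v)` that glues the two end disks of the cylinder. The projection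
plane goes to the 2-sphere `Im z₂ = 0`, on which the end points on the right are thus joined to
those on the left without new crossings. -/
def tangleClosure (T : Set (ℝ × ℂ)) : Set S3 :=
  {p | ∃ a ∈ T, p.1 =
    ((Real.sqrt (1 - ‖a.2‖ ^ 2) : ℂ) * Complex.exp (2 * Real.pi * a.1 * Complex.I), a.2)}

/-- The closure of `σ^{i₁} T σ^{i₂} T ⋯ σ^{i_q} T`. -/
def virtuallyVisibleClosure {q : ℕ} (i : Fin q → ℤ) (T : Set (ℝ × ℂ)) : Set S3 :=
  tangleClosure (tangleSum fun j => tangleSum ![braidPow (i j), T])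

end

end KnotPeriod

namespace KnotPeriod

/-! In the coordinates of `closureMap`, translation along the cylinder becomes rotation of z₁ and
turning its disks becomes rotation of z₂. The aim is to carry the closure, by a homeomorphism of S³,
onto a union of q congruent blocks permuted by the rotation with angles (2π/q, 2πb/q).

Two moves achieve this. First, a flype is realised by a homeomorphism supported in the open
cylinder: the crossing slides through the subtangle, which makes a half turn
(`ambientEquiv_crossing_slide`). Hence a symmetric T may be replaced by T turned by any number of
half turns, independently in each of the q places. Second, turning the slices by an angle that
vanishes at both ends (`twistAngle`) spreads the total twist πw evenly, so that each block carries β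
= πw/q. For consecutive copies of T to differ by a single angle α, matching of the strands forces α
= β + πt with t an integer, and the half turns of the first move realise each such t. Writing α =
2πb/q, the condition is 2b = w + qt (`exists_homeomorph_rotatedBlocks`).

If q divides w, then t = -w/q gives b = 0: a rotation about the circle z₁ = 0, which the tangle
misses because it stays off the lateral boundary. If w is prime to q, then t = w gives b = w(q+1)/2,
an integer prime to q since q is odd, and the rotation generates a free action. -/

/-! ### Homeomorphisms supported in the cylinder. -/

/-- `A` and `B` correspond by a homeomorphism of space supported in the open solid cylinder. -/
def AmbientEquiv (A B : Set (ℝ × ℂ)) : Prop :=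
  ∃ H : (ℝ × ℂ) ≃ₜ (ℝ × ℂ), (∀ p, p ∉ interior cylinder → H p = p) ∧ H '' A = B

theorem AmbientEquiv.refl (A : Set (ℝ × ℂ)) : AmbientEquiv A A :=
  ⟨Homeomorph.refl _, fun _ _ => rfl, by simp⟩

theorem AmbientEquiv.symm {A B : Set (ℝ × ℂ)} (h : AmbientEquiv A B) : AmbientEquiv B A := by
  obtain ⟨H, hH, rfl⟩ := h
  refine ⟨H.symm, fun p hp => ?_, by simp [← image_comp]⟩
  rw [Homeomorph.symm_apply_eq, hH p hp]

theorem AmbientEquiv.trans {A B C : Set (ℝ × ℂ)} (h : AmbientEquiv A B) (h' : AmbientEquiv B C) :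
    AmbientEquiv A C := by
  obtain ⟨H, hH, rfl⟩ := h
  obtain ⟨G, hG, rfl⟩ := h'
  exact ⟨H.trans G, fun p hp => by simp [hH p hp, hG p hp], image_comp G H A⟩

theorem interior_cylinder :
    interior cylinder = Ioo (0 : ℝ) 1 ×ˢ Metric.ball (0 : ℂ) 1 := by
  rw [cylinder, interior_prod_eq, interior_Icc, interior_closedBall _ one_ne_zero]

/-- An equivalence performed inside an embedded copy of the cylinder. -/
theorem AmbientEquiv.conj {A B R : Set (ℝ × ℂ)} (h : AmbientEquiv A B)
    (H : (ℝ × ℂ) ≃ₜ (ℝ × ℂ)) (hH : H '' cylinder ⊆ cylinder)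
    (hR : Disjoint R (H '' interior cylinder)) : AmbientEquiv (H '' A ∪ R) (H '' B ∪ R) := by
  obtain ⟨G, hG, rfl⟩ := h
  -- The conjugate of `G` by `H` is supported in the embedded open cylinder, so it fixes both `R`
  -- and everything off the large open cylinder.
  have key : ∀ p, p ∉ H '' interior cylinder → H (G (H.symm p)) = p := by
    intro p hp
    rw [hG, Homeomorph.apply_symm_apply]
    exact fun h => hp ⟨_, h, H.apply_symm_apply p⟩
  refine ⟨(H.symm.trans G).trans H, fun p hp => key p fun h => hp ?_, ?_⟩
  · rw [H.image_interior] at h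
    exact interior_mono hH h
  · rw [image_union]
    congr 1
    · simp [image_image]
    · refine (image_congr fun p hp => ?_).trans (image_id R)
      exact key p (disjoint_left.1 hR hp)

/-! ### Sliding and turning the slices. -/

/-- The cutoff function of the radius: `1` on the disk of radius `r`, `0` off the unit disk. -/
noncomputable def cutoff (r s : ℝ) : ℝ := max 0 (min 1 ((1 - s) / (1 - r)))

theorem continuous_cutoff (r : ℝ) : Continuous (cutoff r) := by
  unfold cutoff; fun_prop

theorem cutoff_nonneg (r s : ℝ) : 0 ≤ cutoff r s := le_max_left _ _

theorem cutoff_le_one (r s : ℝ) : cutoff r s ≤ 1 := max_le zero_le_one (min_le_left _ _)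

theorem cutoff_eq_one {r s : ℝ} (hr : r < 1) (hs : s ≤ r) : cutoff r s = 1 := by
  have : 1 ≤ (1 - s) / (1 - r) := by rw [le_div_iff₀ (by linarith)]; linarith
  rw [cutoff, min_eq_left this, max_eq_right zero_le_one]

theorem cutoff_eq_zero {r s : ℝ} (hr : r < 1) (hs : 1 ≤ s) : cutoff r s = 0 :=
  max_eq_left ((min_le_right _ _).trans (div_nonpos_of_nonpos_of_nonneg (by linarith)
    (by linarith)))

/-- A homeomorphism that slides the disks of the cylinder by `ψ` and turns them by `θ`, damped
near the lateral boundary. -/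
noncomputable def slideTwist (r : ℝ) (ψ θ : ℝ → ℝ) (p : ℝ × ℂ) : ℝ × ℂ :=
  (p.1 + cutoff r ‖p.2‖ * (ψ p.1 - p.1),
    Complex.exp ((cutoff r ‖p.2‖ * θ p.1 : ℝ) * Complex.I) * p.2)

theorem slideTwist_norm (r : ℝ) (ψ θ : ℝ → ℝ) (p : ℝ × ℂ) : ‖(slideTwist r ψ θ p).2‖ = ‖p.2‖ := by
  simp only [slideTwist, norm_mul, Complex.norm_exp_ofReal_mul_I, one_mul]

theorem continuous_slideTwist (r : ℝ) {ψ θ : ℝ → ℝ} (hψ : Continuous ψ) (hθ : Continuous θ) :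
    Continuous (slideTwist r ψ θ) := by
  have := continuous_cutoff r
  unfold slideTwist
  fun_prop

theorem slideTwist_of_le {r : ℝ} (hr : r < 1) (ψ θ : ℝ → ℝ) {p : ℝ × ℂ} (hp : ‖p.2‖ ≤ r) :
    slideTwist r ψ θ p = (ψ p.1, Complex.exp (θ p.1 * Complex.I) * p.2) := by
  simp [slideTwist, cutoff_eq_one hr hp]

theorem slideTwist_of_notMem {r : ℝ} (hr : r < 1) {ψ θ : ℝ → ℝ}
    (hψ0 : ∀ y, y ≤ 0 ∨ 1 ≤ y → ψ y = y) (hθ0 : ∀ y, y ≤ 0 ∨ 1 ≤ y → θ y = 0) {p : ℝ × ℂ}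
    (hp : p ∉ interior cylinder) : slideTwist r ψ θ p = p := by
  by_cases h : p.1 ≤ 0 ∨ 1 ≤ p.1
  · simp [slideTwist, hψ0 _ h, hθ0 _ h]
  · have : 1 ≤ ‖p.2‖ := by
      by_contra! h'
      push Not at h
      exact hp (by rw [interior_cylinder]; exact ⟨⟨h.1, h.2⟩, by simpa using h'⟩)
    simp [slideTwist, cutoff_eq_zero hr this]

/-- The radius is preserved. At a fixed radius the first coordinate moves by a convex combination of
the identity and `ψ`, which is strictly increasing and agrees with the identity outside the unit
interval; the turn is then undone slice by slice. -/
theorem slideTwist_bijective (r : ℝ) {ψ θ : ℝ → ℝ} (hψ : Continuous ψ) (hm : StrictMono ψ)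
    (hψ0 : ∀ y, y ≤ 0 ∨ 1 ≤ y → ψ y = y) : Function.Bijective (slideTwist r ψ θ) := by
  have mono : ∀ s, StrictMono fun x => x + cutoff r s * (ψ x - x) := by
    intro s x y hxy
    have h0 := cutoff_nonneg r s
    have h1 := cutoff_le_one r s
    have := hm hxy
    rcases h1.lt_or_eq with h1 | h1
    · show x + cutoff r s * (ψ x - x) < y + cutoff r s * (ψ y - y)
      nlinarith [mul_pos (sub_pos.2 h1) (sub_pos.2 hxy), mul_nonneg h0 (sub_pos.2 this).le]
    · simpa [h1] using this
  refine ⟨fun p p' h => ?_, fun p => ?_⟩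
  · have hn : ‖p.2‖ = ‖p'.2‖ := by
      rw [← slideTwist_norm r ψ θ p, h, slideTwist_norm]
    have h1 := congrArg Prod.fst h
    have h2 := congrArg Prod.snd h
    simp only [slideTwist, hn] at h1 h2
    have e := (mono ‖p'.2‖).injective h1
    rw [e] at h2
    exact Prod.ext e (mul_left_cancel₀ (Complex.exp_ne_zero _) h2)
  · set s := ‖p.2‖ with hs
    obtain ⟨x, hx⟩ : ∃ x, x + cutoff r s * (ψ x - x) = p.1 := by
      have hc : Continuous fun x => x + cutoff r s * (ψ x - x) := by fun_prop
      have hlo := hψ0 (min 0 p.1) (Or.inl (min_le_left _ _))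
      have hhi := hψ0 (max 1 p.1) (Or.inr (le_max_left _ _))
      exact mem_range_of_exists_le_of_exists_ge (c := p.1) hc
        ⟨min 0 p.1, by simp only [hlo]; simp⟩ ⟨max 1 p.1, by simp only [hhi]; simp⟩
    refine ⟨(x, Complex.exp (-((cutoff r s * θ x : ℝ) * Complex.I)) * p.2), ?_⟩
    have hn : ‖Complex.exp (-((cutoff r s * θ x : ℝ) * Complex.I)) * p.2‖ = s := by
      rw [norm_mul, ← neg_mul, ← Complex.ofReal_neg, Complex.norm_exp_ofReal_mul_I, one_mul]
    simp only [slideTwist, hn]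
    refine Prod.ext hx ?_
    rw [← mul_assoc, ← Complex.exp_add, add_neg_cancel, Complex.exp_zero, one_mul]

theorem isCompact_cylinder : IsCompact cylinder :=
  isCompact_Icc.prod (isCompact_closedBall _ _)

/-- Two subsets of the cylinder, away from the lateral boundary, whose slices correspond by a
reparametrization and a rotation depending on the slice, are equivalent. -/
theorem AmbientEquiv.of_slices {A B : Set (ℝ × ℂ)} {r : ℝ} (hr : r < 1)
    (hA : A ⊆ Icc 0 1 ×ˢ Metric.closedBall 0 r) (hB : B ⊆ Icc 0 1 ×ˢ Metric.closedBall 0 r)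
    {ψ θ : ℝ → ℝ} (hψ : Continuous ψ) (hm : StrictMono ψ) (hψ0 : ∀ y, y ≤ 0 ∨ 1 ≤ y → ψ y = y)
    (hθ : Continuous θ) (hθ0 : ∀ y, y ≤ 0 ∨ 1 ≤ y → θ y = 0)
    (h : ∀ y ∈ Icc (0 : ℝ) 1, ∀ v : ℂ,
      (y, v) ∈ B ↔ (ψ y, Complex.exp (θ y * Complex.I) * v) ∈ A) : AmbientEquiv B A := by
  have hfix : ∀ p, p ∉ interior cylinder → slideTwist r ψ θ p = p :=
    fun p => slideTwist_of_notMem hr hψ0 hθ0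
  have hcont := continuous_slideTwist r hψ hθ
  -- Being the identity off a compact set, the map is proper, hence closed; a continuous closed
  -- bijection is a homeomorphism.
  have hclosed : IsClosedMap (slideTwist r ψ θ) := by
    refine (isProperMap_iff_tendsto_cocompact.2 ⟨hcont, ?_⟩).isClosedMap
    refine Filter.tendsto_id.congr' ?_
    filter_upwards [isCompact_cylinder.compl_mem_cocompact] with p hp
    exact (hfix p fun h => hp (interior_subset h)).symm
  refine ⟨(Equiv.ofBijective _ (slideTwist_bijective r (θ := θ) hψ hm hψ0)).toHomeomorphOfContinuousClosed
    hcont hclosed, hfix, ?_⟩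
  ext p
  constructor
  · rintro ⟨⟨y, v⟩, hp, rfl⟩
    have hp' := hB hp
    show slideTwist r ψ θ (y, v) ∈ A
    rw [slideTwist_of_le hr ψ θ (by simpa using hp'.2)]
    exact (h y hp'.1 v).1 hp
  · intro hp
    obtain ⟨⟨y, v⟩, rfl⟩ := (slideTwist_bijective r (θ := θ) hψ hm hψ0).2 p
    refine ⟨(y, v), ?_, rfl⟩
    have hp' := hA hp
    have hv : ‖v‖ ≤ r := by
      have := hp'.2
      rwa [mem_closedBall_zero_iff, slideTwist_norm] at this
    rw [slideTwist_of_le hr ψ θ hv] at hp hp'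
    have hy : ψ y ∈ Icc (0 : ℝ) 1 := hp'.1
    refine (h y ?_ v).2 hp
    constructor
    · by_contra! hlt
      rw [hψ0 y (Or.inl hlt.le)] at hy
      exact absurd hy.1 hlt.not_ge
    · by_contra! hlt
      rw [hψ0 y (Or.inr hlt.le)] at hy
      exact absurd hy.2 hlt.not_ge

/-! ### Strands, braids and tangle sums. -/

theorem continuous_ramp : Continuous ramp := by
  unfold ramp; fun_prop

theorem ramp_eq_zero {x : ℝ} (hx : x ≤ 1 / 3) : ramp x = 0 :=
  max_eq_left ((min_le_right _ _).trans (by linarith))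

theorem ramp_eq_one {x : ℝ} (hx : 2 / 3 ≤ x) : ramp x = 1 := by
  rw [ramp, min_eq_left (by linarith), max_eq_right zero_le_one]

/-- `v` is one of the two antipodal points `±c / 2`. -/
def OnStrands (c v : ℂ) : Prop := v = 1 / 2 * c ∨ v = -1 / 2 * c

theorem onStrands_one {v : ℂ} : OnStrands 1 v ↔ v = 1 / 2 ∨ v = -1 / 2 := by
  simp [OnStrands]

theorem onStrands_mul {a : ℂ} (ha : a ≠ 0) (c v : ℂ) :
    OnStrands (a * c) (a * v) ↔ OnStrands c v := by
  simp only [OnStrands, mul_left_comm _ a, mul_right_inj' ha]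

theorem onStrands_neg_left (c v : ℂ) : OnStrands (-c) v ↔ OnStrands c v := by
  simp only [OnStrands]
  rw [or_comm]
  ring_nf

theorem onStrands_neg_right (c v : ℂ) : OnStrands c (-v) ↔ OnStrands c v := by
  rw [← onStrands_neg_left, ← neg_one_mul c, ← neg_one_mul v, onStrands_mul (by norm_num)]

theorem OnStrands.norm {c v : ℂ} (h : OnStrands c v) : ‖v‖ = ‖c‖ / 2 := by
  rcases h with rfl | rfl <;> simp <;> ring

theorem mem_braidPow {n : ℤ} {x : ℝ} {v : ℂ} : (x, v) ∈ braidPow n ↔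
    x ∈ Icc (0 : ℝ) 1 ∧ OnStrands (Complex.exp ((Real.pi * n * ramp x : ℝ) * Complex.I)) v := by
  simp [braidPow, OnStrands]

theorem mem_halfTurn {T : Set (ℝ × ℂ)} {x : ℝ} {v : ℂ} : (x, v) ∈ halfTurn T ↔ (x, -v) ∈ T := by
  constructor
  · rintro ⟨⟨y, w⟩, h, e⟩
    simp only [Prod.mk.injEq] at e
    obtain ⟨rfl, rfl⟩ := e
    simpa using h
  · exact fun h => ⟨_, h, by simp⟩

theorem mem_tangleSum_two {A B : Set (ℝ × ℂ)} {x : ℝ} {v : ℂ} :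
    (x, v) ∈ tangleSum ![A, B] ↔ (2 * x, v) ∈ A ∨ (2 * x - 1, v) ∈ B := by
  constructor
  · rintro ⟨j, ⟨y, w⟩, h, e⟩
    simp only [Prod.mk.injEq] at e
    obtain ⟨rfl, rfl⟩ := e
    fin_cases j
    · left
      have e : 2 * ((((⟨0, by omega⟩ : Fin 2) : ℕ) + y) / ((2 : ℕ) : ℝ)) = y := by simp; ring
      rw [← e] at h
      exact h
    · right
      have e : 2 * ((((⟨1, by omega⟩ : Fin 2) : ℕ) + y) / ((2 : ℕ) : ℝ)) - 1 = y := by simp; ring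
      rw [← e] at h
      exact h
  · rintro (h | h)
    · exact ⟨0, _, h, by simp⟩
    · exact ⟨1, _, h, by simp⟩

theorem tangleSum_subset {n : ℕ} {T : Fin n → Set (ℝ × ℂ)} {D : Set ℂ}
    (h : ∀ j, T j ⊆ Icc 0 1 ×ˢ D) : tangleSum T ⊆ Icc 0 1 ×ˢ D := by
  rintro _ ⟨j, a, ha, rfl⟩
  obtain ⟨h1, h2⟩ := h j ha
  have hn : (0 : ℝ) < n := by exact_mod_cast j.pos
  have hj : (j : ℝ) + 1 ≤ n := by exact_mod_cast j.isLt
  refine ⟨⟨?_, ?_⟩, h2⟩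
  · have := h1.1
    positivity
  · have := h1.2
    rw [div_le_one hn]
    linarith

theorem tangleSum_two_subset {A B : Set (ℝ × ℂ)} {D : Set ℂ} (hA : A ⊆ Icc 0 1 ×ˢ D)
    (hB : B ⊆ Icc 0 1 ×ˢ D) : tangleSum ![A, B] ⊆ Icc 0 1 ×ˢ D :=
  tangleSum_subset fun j => by fin_cases j <;> assumption

theorem braidPow_subset (n : ℤ) {r : ℝ} (hr : 1 / 2 ≤ r) :
    braidPow n ⊆ Icc 0 1 ×ˢ Metric.closedBall 0 r := by
  rintro ⟨x, v⟩ h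
  rw [mem_braidPow] at h
  refine ⟨h.1, ?_⟩
  have := h.2.norm
  rw [Complex.norm_exp_ofReal_mul_I] at this
  simpa [this] using hr

theorem halfTurn_subset {T : Set (ℝ × ℂ)} {r : ℝ} (h : T ⊆ Icc 0 1 ×ˢ Metric.closedBall 0 r) :
    halfTurn T ⊆ Icc 0 1 ×ˢ Metric.closedBall 0 r := by
  rintro ⟨x, v⟩ hp
  obtain ⟨h1, h2⟩ := h (mem_halfTurn.1 hp)
  exact ⟨h1, by simpa using h2⟩

/-- Compactness of the strings leaves a margin near the lateral boundary, where the damping of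
`slideTwist` takes place. The bound 1/2 makes room for the braid strands as well. -/
theorem IsTangle.exists_radius {T : Set (ℝ × ℂ)} (hT : IsTangle T) :
    ∃ r : ℝ, 1 / 2 ≤ r ∧ r < 1 ∧ T ⊆ Icc 0 1 ×ˢ Metric.closedBall 0 r := by
  obtain ⟨hsub, ⟨γ, hγ, -, rfl, -⟩, -⟩ := hT
  have hc : IsCompact (Prod.snd '' ⋃ k, range (γ k)) :=
    (isCompact_iUnion fun k => isCompact_range (hγ k)).image continuous_snd
  obtain ⟨r, hr, hr'⟩ := exists_lt_subset_ball hc.isClosed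
    (x := (0 : ℂ)) (r := 1) (by rintro _ ⟨p, hp, rfl⟩; exact (hsub hp).2)
  refine ⟨max (1 / 2) r, le_max_left _ _, max_lt (by norm_num) hr, fun p hp => ⟨(hsub hp).1, ?_⟩⟩
  exact Metric.closedBall_subset_closedBall (le_max_right _ _)
    (Metric.ball_subset_closedBall (hr' ⟨p, hp, rfl⟩))

theorem exp_pi_mul_odd {ε : ℤ} (hε : ε = 1 ∨ ε = -1) :
    Complex.exp ((Real.pi * ε : ℝ) * Complex.I) = -1 := by
  rcases hε with rfl | rfl
  · simp
  · simp [Complex.exp_neg]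

/-! ### Flypes as homeomorphisms of the cylinder. -/

/-- The reparametrization of the interval that moves the middle part `[δ/2, 1/2 - δ/2]` by `1/2`
to the right. -/
noncomputable def shiftRight (δ y : ℝ) : ℝ :=
  max y (min (y + 1 / 2) (min (y + y / δ) (y + (1 - y) / (1 + δ))))

theorem continuous_shiftRight (δ : ℝ) : Continuous (shiftRight δ) := by
  unfold shiftRight; fun_prop

/-- Maxima and minima keep strict monotonicity, and the affine functions involved have the positive
slopes 1, 1 + 1/δ and δ/(1 + δ). -/
theorem strictMono_shiftRight {δ : ℝ} (hδ : 0 < δ) : StrictMono (shiftRight δ) := by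
  intro x y h
  refine max_lt_max h (min_lt_min (by simpa using h) (min_lt_min ?_ ?_))
  · gcongr
  · have e : y + (1 - y) / (1 + δ) - (x + (1 - x) / (1 + δ)) = (y - x) * (δ / (1 + δ)) := by
      field_simp; ring
    have : 0 < (y - x) * (δ / (1 + δ)) := mul_pos (sub_pos.2 h) (by positivity)
    linarith

theorem shiftRight_of_le {δ y : ℝ} (hδ : 0 < δ) (h0 : 0 ≤ y) (hδ1 : δ < 1 / 2) (hy : y ≤ δ / 2) :
    shiftRight δ y = y + y / δ := by
  have h1 : y / δ ≤ 1 / 2 := by rw [div_le_iff₀ hδ]; linarith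
  have h2 : y / δ ≤ (1 - y) / (1 + δ) := by
    rw [le_div_iff₀ (by linarith)]; nlinarith [div_nonneg h0 hδ.le]
  rw [shiftRight, min_eq_left (b := y + (1 - y) / (1 + δ)) (by linarith),
    min_eq_right (by linarith), max_eq_right]
  linarith [div_nonneg h0 hδ.le]

theorem shiftRight_of_mid {δ y : ℝ} (hδ : 0 < δ) (h0 : δ / 2 ≤ y) (h1 : y ≤ 1 / 2 - δ / 2) :
    shiftRight δ y = y + 1 / 2 := by
  have h2 : 1 / 2 ≤ y / δ := by rw [le_div_iff₀ hδ]; linarith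
  have h3 : 1 / 2 ≤ (1 - y) / (1 + δ) := by rw [le_div_iff₀ (by linarith)]; linarith
  rw [shiftRight, min_eq_left (le_min (by linarith) (by linarith)), max_eq_right (by linarith)]

theorem shiftRight_of_ge {δ y : ℝ} (hδ : 0 < δ) (hδ1 : δ < 1 / 2) (h0 : 1 / 2 - δ / 2 ≤ y)
    (h1 : y ≤ 1) : shiftRight δ y = y + (1 - y) / (1 + δ) := by
  have h3 : (1 - y) / (1 + δ) ≤ 1 / 2 := by rw [div_le_iff₀ (by linarith)]; linarith
  have h2 : (1 - y) / (1 + δ) ≤ y / δ := by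
    refine h3.trans ?_
    rw [le_div_iff₀ hδ]; linarith
  have h4 : 0 ≤ (1 - y) / (1 + δ) := div_nonneg (by linarith) (by linarith)
  rw [shiftRight, min_eq_right (a := y + y / δ) (by linarith),
    min_eq_right (by linarith), max_eq_right (by linarith)]

theorem shiftRight_of_notMem {δ y : ℝ} (hδ : 0 < δ) (h : y ≤ 0 ∨ 1 ≤ y) : shiftRight δ y = y := by
  refine max_eq_left ?_
  rcases h with h | h
  · refine (min_le_right _ _).trans ((min_le_left _ _).trans ?_)
    linarith [div_nonpos_of_nonpos_of_nonneg h hδ.le]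
  · refine (min_le_right _ _).trans ((min_le_right _ _).trans ?_)
    linarith [div_nonpos_of_nonpos_of_nonneg (sub_nonpos.2 h) (by linarith : 0 ≤ 1 + δ)]

/-- A crossing moves through a tangle, which makes a half turn. -/
theorem ambientEquiv_crossing_slide {S : Set (ℝ × ℂ)} (hS : IsTangle S) {ε : ℤ}
    (hε : ε = 1 ∨ ε = -1) :
    AmbientEquiv (tangleSum ![braidPow ε, S]) (tangleSum ![halfTurn S, braidPow ε]) := by
  obtain ⟨r, hr, hr1, hSr⟩ := hS.exists_radius
  obtain ⟨δ, hδ, hδ1, hend⟩ : ∃ δ : ℝ, 0 < δ ∧ δ < 1 / 2 ∧ ∀ x v, x ∈ Icc 0 δ ∪ Icc (1 - δ) 1 →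
      ((x, v) ∈ S ↔ OnStrands 1 v) := by
    obtain ⟨δ, hδ, h⟩ := hS.2.2
    -- Shrinking the straight collars of `S` below width 1/2 keeps the two ends apart.
    refine ⟨min δ (1 / 3), by positivity, (min_le_right _ _).trans_lt (by norm_num),
      fun x v hx => (h (x, v) ?_).trans onStrands_one.symm⟩
    have := min_le_left δ (1 / 3)
    rcases hx with hx | hx
    · exact Or.inl ⟨hx.1, hx.2.trans this⟩
    · exact Or.inr ⟨by linarith [hx.1], hx.2⟩
  have hSx : ∀ {x v}, (x, v) ∈ S → 0 ≤ x ∧ x ≤ 1 := fun h => (hSr h).1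
  have hb := braidPow_subset ε hr
  -- The braid angle in the source at the shifted slice, minus the braid angle in the target.
  set θ : ℝ → ℝ := fun y =>
    Real.pi * ε * ramp (2 * shiftRight δ y) - Real.pi * ε * ramp (2 * y - 1) with hθ
  have hodd := exp_pi_mul_odd hε
  refine (AmbientEquiv.of_slices hr1 (tangleSum_two_subset hb hSr)
    (tangleSum_two_subset (halfTurn_subset hSr) hb) (continuous_shiftRight δ)
    (strictMono_shiftRight hδ) (fun y => shiftRight_of_notMem hδ) (θ := θ) ?_ ?_ ?_).symm
  · have := continuous_ramp
    have := continuous_shiftRight δ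
    fun_prop
  · rintro y hy
    simp only [hθ, shiftRight_of_notMem hδ hy]
    rcases hy with hy | hy
    · rw [ramp_eq_zero (by linarith), ramp_eq_zero (by linarith), sub_self]
    · rw [ramp_eq_one (by linarith), ramp_eq_one (by linarith), sub_self]
  · rintro y ⟨hy0, hy1⟩ v
    rw [mem_tangleSum_two, mem_tangleSum_two, mem_halfTurn, mem_braidPow, mem_braidPow]
    -- West end: the straight first collar of the turned tangle is stretched over the whole crossing
    -- together with the first collar of `S`.
    rcases le_total y (δ / 2) with hya | hya
    · have hψ := shiftRight_of_le hδ hy0 hδ1 hya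
      have hψ1 : y / δ ≤ 1 / 2 := by rw [div_le_iff₀ hδ]; linarith
      have hψ0 := div_nonneg hy0 hδ.le
      set s := shiftRight δ y
      have hθy : θ y = Real.pi * ε * ramp (2 * s) := by
        simp only [hθ]; rw [ramp_eq_zero (x := 2 * y - 1) (by linarith)]; simp [s]
      rw [hend (2 * y) _ (Or.inl ⟨by linarith, by linarith⟩), onStrands_neg_right,
        or_iff_left (by rintro ⟨h, -⟩; linarith [h.1]), hθy]
      have hstr : OnStrands (Complex.exp ((Real.pi * ε * ramp (2 * s) : ℝ) * Complex.I))
          (Complex.exp ((Real.pi * ε * ramp (2 * s) : ℝ) * Complex.I) * v) ↔ OnStrands 1 v := by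
        rw [← onStrands_mul (Complex.exp_ne_zero _) 1 v, mul_one]
      have hend' : 1 ≤ 2 * s →
          ((2 * s - 1, Complex.exp ((Real.pi * ε * ramp (2 * s) : ℝ) * Complex.I) * v) ∈ S ↔
            OnStrands 1 v) := by
        intro h
        rw [hend _ _ (Or.inl ⟨by linarith, by linarith⟩), ramp_eq_one (by linarith), mul_one, hodd,
          neg_one_mul, onStrands_neg_right]
      rw [hstr]
      constructor
      · intro h
        rcases le_total (2 * s) 1 with hs | hs
        · exact Or.inl ⟨⟨by linarith, hs⟩, h⟩
        · exact Or.inr ((hend' hs).2 h)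
      · rintro (h | h)
        · exact h.2
        · exact (hend' (by linarith [(hSx h).1])).1 h
    -- Middle: a translation by 1/2 with constant angle ±π, which is the half turn of `S`.
    rcases le_total y (1 / 2 - δ / 2) with hyb | hyb
    · have hψ := shiftRight_of_mid hδ hya hyb
      have hθy : θ y = Real.pi * ε := by
        simp only [hθ]
        rw [ramp_eq_zero (x := 2 * y - 1) (by linarith), hψ, ramp_eq_one (by linarith)]; simp
      rw [hψ, hθy, hodd, neg_one_mul, or_iff_left (by rintro ⟨h, -⟩; linarith [h.1]),
        or_iff_right (by rintro ⟨h, -⟩; linarith [h.2]), show 2 * (y + 1 / 2) - 1 = 2 * y by ring]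
    -- East end: the last collar of the turned tangle and the crossing are compressed into the last
    -- collar of `S`.
    · have hψ := shiftRight_of_ge hδ hδ1 hyb hy1
      have h4 : 0 ≤ (1 - y) / (1 + δ) := div_nonneg (by linarith) (by linarith)
      have h5 : (1 - y) / (1 + δ) ≤ 1 - y := div_le_self (by linarith) (by linarith)
      have h6 : 1 - δ / 2 ≤ y + (1 - y) / (1 + δ) := by
        have e : y + (1 - y) / (1 + δ) - (1 - δ / 2) = (y - (1 / 2 - δ / 2)) * (δ / (1 + δ)) := by
          field_simp; ring
        have : 0 ≤ (y - (1 / 2 - δ / 2)) * (δ / (1 + δ)) := mul_nonneg (by linarith) (by positivity)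
        linarith
      set s := shiftRight δ y
      have hexp : Complex.exp ((θ y : ℝ) * Complex.I) =
          -Complex.exp (-((Real.pi * ε * ramp (2 * y - 1) : ℝ) * Complex.I)) := by
        simp only [hθ]
        rw [ramp_eq_one (by linarith), mul_one, Complex.ofReal_sub, sub_mul, sub_eq_add_neg,
          Complex.exp_add, hodd, neg_one_mul]
      rw [hexp, or_iff_right (a := _ ∧ OnStrands _ (_ * v)) (by rintro ⟨h, -⟩; linarith [h.2]),
        hend (2 * s - 1) _ (Or.inr ⟨by linarith, by linarith⟩), neg_mul, onStrands_neg_right]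
      have hstr : OnStrands 1
          (Complex.exp (-((Real.pi * ε * ramp (2 * y - 1) : ℝ) * Complex.I)) * v) ↔
          OnStrands (Complex.exp ((Real.pi * ε * ramp (2 * y - 1) : ℝ) * Complex.I)) v := by
        rw [← onStrands_mul (Complex.exp_ne_zero (-((Real.pi * ε * ramp (2 * y - 1) : ℝ) * Complex.I)))
            (Complex.exp _) v, ← Complex.exp_add, neg_add_cancel, Complex.exp_zero]
      have hend' : y ≤ 1 / 2 → ((2 * y, -v) ∈ S ↔
          OnStrands (Complex.exp ((Real.pi * ε * ramp (2 * y - 1) : ℝ) * Complex.I)) v) := by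
        intro h
        rw [hend _ _ (Or.inr ⟨by linarith, by linarith⟩), ramp_eq_zero (by linarith), mul_zero,
          onStrands_neg_right]
        simp
      rw [hstr]
      constructor
      · rintro (h | h)
        · exact (hend' (by linarith [(hSx h).2])).1 h
        · exact h.2
      · intro h
        rcases le_total y (1 / 2) with hs | hs
        · exact Or.inl ((hend' hs).2 h)
        · exact Or.inr ⟨⟨by linarith, by linarith⟩, h⟩

/-- The crossing slide takes place inside the embedded cylinder, and the parts of the two tangles
outside it coincide. -/
theorem Flype.ambientEquiv {A B : Set (ℝ × ℂ)} (h : Flype A B) : AmbientEquiv A B := by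
  obtain ⟨H, -, S, ε, -, -, hH, -, hS, hε, hA, hB, hAB⟩ := h
  have := (ambientEquiv_crossing_slide hS hε).conj H hH (R := A \ H '' cylinder)
    (disjoint_left.2 fun p hp hp' => hp.2 (image_mono interior_subset hp'))
  rwa [← hA, inter_union_sdiff, ← hB, hAB, inter_union_sdiff] at this

theorem FlypeEquiv.ambientEquiv {A B : Set (ℝ × ℂ)} (h : FlypeEquiv A B) : AmbientEquiv A B := by
  induction h with
  | rel A B h =>
    rcases h with ⟨H, -, hH, -, hAB, -⟩ | h
    · exact ⟨H, hH, hAB⟩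
    · exact h.ambientEquiv
  | refl A => exact .refl A
  | symm A B _ ih => exact ih.symm
  | trans A B C _ _ ih ih' => exact ih.trans ih'

/-! ### Replacing the terms of a tangle sum. -/

/-- The embedding of the cylinder as the `j`-th slot of a sum of `n` tangles. -/
noncomputable def slot {n : ℕ} (j : Fin n) : (ℝ × ℂ) ≃ₜ (ℝ × ℂ) where
  toFun p := (((j : ℝ) + p.1) / n, p.2)
  invFun p := (n * p.1 - j, p.2)
  left_inv p := by
    have : (n : ℝ) ≠ 0 := by exact_mod_cast j.pos.ne'
    ext1
    · show (n : ℝ) * (((j : ℝ) + p.1) / n) - j = p.1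
      field_simp; ring
    · rfl
  right_inv p := by
    have : (n : ℝ) ≠ 0 := by exact_mod_cast j.pos.ne'
    ext1
    · show ((j : ℝ) + (n * p.1 - j)) / n = p.1
      field_simp; ring
    · rfl
  continuous_toFun := by fun_prop
  continuous_invFun := by fun_prop

theorem slot_apply {n : ℕ} (j : Fin n) (p : ℝ × ℂ) : slot j p = (((j : ℝ) + p.1) / n, p.2) := rfl

theorem tangleSum_eq_slot {n : ℕ} (T : Fin n → Set (ℝ × ℂ)) (j : Fin n) :
    tangleSum T = slot j '' T j ∪ {p | ∃ k ≠ j, ∃ a ∈ T k, p = slot k a} := by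
  ext p
  constructor
  · rintro ⟨k, a, ha, rfl⟩
    rcases eq_or_ne k j with rfl | hk
    · exact Or.inl ⟨a, ha, rfl⟩
    · exact Or.inr ⟨k, hk, a, ha, rfl⟩
  · rintro (⟨a, ha, rfl⟩ | ⟨k, -, a, ha, rfl⟩)
    · exact ⟨j, a, ha, rfl⟩
    · exact ⟨k, a, ha, rfl⟩

/-- The other terms meet the slot `j` at most in its end disks, so a homeomorphism supported in the
open slot leaves them alone. -/
theorem AmbientEquiv.tangleSum_update {n : ℕ} {T : Fin n → Set (ℝ × ℂ)} {j : Fin n}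
    {B : Set (ℝ × ℂ)} (hT : ∀ k, T k ⊆ Icc 0 1 ×ˢ univ) (h : AmbientEquiv (T j) B) :
    AmbientEquiv (tangleSum T) (tangleSum (Function.update T j B)) := by
  rw [tangleSum_eq_slot T j, tangleSum_eq_slot (Function.update T j B) j, Function.update_self]
  have e : {p | ∃ k ≠ j, ∃ a ∈ Function.update T j B k, p = slot k a} =
      {p | ∃ k ≠ j, ∃ a ∈ T k, p = slot k a} := by
    ext p
    refine exists_congr fun k => and_congr_right fun hk => ?_
    rw [Function.update_of_ne hk]
  rw [e]
  have hn : (0 : ℝ) < n := by exact_mod_cast j.pos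
  refine h.conj _ ?_ (disjoint_left.2 ?_)
  · rintro _ ⟨⟨x, v⟩, ⟨hx, hv⟩, rfl⟩
    have hj : (j : ℝ) + 1 ≤ n := by exact_mod_cast j.isLt
    refine ⟨⟨?_, ?_⟩, hv⟩
    · have := hx.1
      simp only [slot_apply]
      positivity
    · have := hx.2
      simp only [slot_apply]
      rw [div_le_one hn]
      simp only at this
      linarith
  · rintro _ ⟨k, hk, ⟨x, v⟩, ha, rfl⟩ ⟨⟨x', v'⟩, hc, e⟩
    rw [interior_cylinder] at hc
    obtain ⟨hx, -⟩ := hT k ha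
    obtain ⟨hx', -⟩ := hc
    simp only [slot_apply, Prod.mk.injEq, div_left_inj' hn.ne'] at e
    simp only [mem_Icc, mem_Ioo] at hx hx'
    refine hk (Fin.ext ?_)
    have h1 : (k : ℝ) < j + 1 := by linarith
    have h2 : (j : ℝ) < k + 1 := by linarith
    have h1' : (k : ℕ) < j + 1 := by exact_mod_cast h1
    have h2' : (j : ℕ) < k + 1 := by exact_mod_cast h2
    omega

theorem AmbientEquiv.tangleSum {n : ℕ} {T T' : Fin n → Set (ℝ × ℂ)}
    (hT : ∀ k, T k ⊆ Icc 0 1 ×ˢ univ) (hT' : ∀ k, T' k ⊆ Icc 0 1 ×ˢ univ)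
    (h : ∀ j, AmbientEquiv (T j) (T' j)) :
    AmbientEquiv (tangleSum T) (KnotPeriod.tangleSum T') := by
  have key : ∀ s : Finset (Fin n),
      AmbientEquiv (KnotPeriod.tangleSum T) (KnotPeriod.tangleSum (s.piecewise T' T)) := by
    intro s
    induction s using Finset.induction_on with
    | empty => simpa using AmbientEquiv.refl _
    | insert j s hj ih =>
      rw [Finset.piecewise_insert]
      refine ih.trans (AmbientEquiv.tangleSum_update (fun k => ?_) ?_)
      · by_cases hk : k ∈ s <;> simp [hk, hT, hT']
      · simpa [hj] using h j
  simpa using key Finset.univ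

/-! ### From the cylinder to the sphere. -/

/-- The map `(x, v) ↦ (√(1 - |v|²) e^{2πix}, v)`. -/
noncomputable def closureMap (a : ℝ × ℂ) : ℂ × ℂ :=
  ((Real.sqrt (1 - ‖a.2‖ ^ 2) : ℂ) * Complex.exp (2 * Real.pi * a.1 * Complex.I), a.2)

theorem continuous_closureMap : Continuous closureMap := by
  unfold closureMap; fun_prop

theorem norm_exp_two_pi (x : ℝ) : ‖Complex.exp (2 * Real.pi * x * Complex.I)‖ = 1 := by
  rw [← Complex.norm_exp_ofReal_mul_I (2 * Real.pi * x)]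
  push_cast
  rfl

theorem closureMap_mem {a : ℝ × ℂ} (ha : a ∈ cylinder) :
    ‖(closureMap a).1‖ ^ 2 + ‖(closureMap a).2‖ ^ 2 = 1 := by
  have hv : ‖a.2‖ ≤ 1 := by simpa using ha.2
  have h0 : 0 ≤ 1 - ‖a.2‖ ^ 2 := by nlinarith [norm_nonneg a.2]
  simp only [closureMap, norm_mul, norm_exp_two_pi, mul_one, Complex.norm_real,
    Real.norm_of_nonneg (Real.sqrt_nonneg _), Real.sq_sqrt h0]
  ring

/-- The quotient map of the cylinder onto the sphere. -/
noncomputable def toSphere (a : cylinder) : S3 := ⟨closureMap a, closureMap_mem a.2⟩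

theorem continuous_toSphere : Continuous toSphere :=
  (continuous_closureMap.comp continuous_subtype_val).subtype_mk _

theorem toSphere_surjective : Function.Surjective toSphere := by
  rintro ⟨⟨z, v⟩, h⟩
  simp only at h
  have hv : ‖v‖ ≤ 1 := by nlinarith [sq_nonneg ‖z‖, norm_nonneg v]
  refine ⟨⟨(Int.fract (z.arg / (2 * Real.pi)), v), ⟨Int.fract_nonneg _, (Int.fract_lt_one _).le⟩,
    by simpa using hv⟩, Subtype.ext (Prod.ext ?_ rfl)⟩
  show (Real.sqrt (1 - ‖v‖ ^ 2) : ℂ) *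
    Complex.exp (2 * Real.pi * (Int.fract (z.arg / (2 * Real.pi)) : ℝ) * Complex.I) = z
  have hz : Real.sqrt (1 - ‖v‖ ^ 2) = ‖z‖ := by
    rw [← h, add_sub_cancel_right, Real.sqrt_sq (norm_nonneg _)]
  have e : 2 * Real.pi * (Int.fract (z.arg / (2 * Real.pi)) : ℝ) * Complex.I =
      z.arg * Complex.I - (⌊z.arg / (2 * Real.pi)⌋ : ℤ) * (2 * Real.pi * Complex.I) := by
    have : (Real.pi : ℂ) ≠ 0 := by exact_mod_cast Real.pi_ne_zero
    rw [Int.fract]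
    push_cast
    field_simp
  rw [hz, e, Complex.exp_sub, Complex.exp_int_mul_two_pi_mul_I, div_one,
    Complex.norm_mul_exp_arg_mul_I]

/-- Only boundary points are identified. A homeomorphism supported in the open cylinder therefore
descends to the quotient. -/
theorem eq_or_notMem_of_closureMap_eq {a b : ℝ × ℂ} (ha : a ∈ cylinder) (hb : b ∈ cylinder)
    (h : closureMap a = closureMap b) :
    a = b ∨ (a ∉ interior cylinder ∧ b ∉ interior cylinder) := by
  obtain ⟨x, v⟩ := a
  obtain ⟨y, w⟩ := b
  simp only [closureMap, Prod.mk.injEq] at h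
  obtain ⟨h1, rfl⟩ := h
  rw [interior_cylinder]
  by_cases hv : ‖v‖ < 1
  · have hs : (Real.sqrt (1 - ‖v‖ ^ 2) : ℂ) ≠ 0 := by
      have : 0 < 1 - ‖v‖ ^ 2 := by nlinarith [norm_nonneg v]
      exact_mod_cast (Real.sqrt_pos.2 this).ne'
    obtain ⟨n, hn⟩ := Complex.exp_eq_exp_iff_exists_int.1 (mul_left_cancel₀ hs h1)
    have hxy : x = y + n := by
      have hpi : (2 * Real.pi * Complex.I : ℂ) ≠ 0 := Complex.two_pi_I_ne_zero
      have : (x : ℂ) = y + n := mul_left_cancel₀ hpi (by linear_combination hn)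
      exact_mod_cast this
    have hx : 0 ≤ x ∧ x ≤ 1 := ha.1
    have hy : 0 ≤ y ∧ y ≤ 1 := hb.1
    rcases lt_trichotomy n 0 with h0 | rfl | h0
    · have : (n : ℝ) ≤ -1 := by exact_mod_cast Int.le_sub_one_of_lt h0
      right
      exact ⟨fun h => by linarith [h.1.1], fun h => by linarith [h.1.2]⟩
    · left; simp [hxy]
    · have : (1 : ℝ) ≤ n := by exact_mod_cast h0
      right
      exact ⟨fun h => by linarith [h.1.2], fun h => by linarith [h.1.1]⟩
  · right
    simp [hv]

theorem mem_cylinder_of_fix {H : (ℝ × ℂ) ≃ₜ (ℝ × ℂ)} (hH : ∀ p, p ∉ interior cylinder → H p = p)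
    {p : ℝ × ℂ} (hp : p ∈ cylinder) : H p ∈ cylinder := by
  by_contra h
  have := H.injective (hH _ fun h' => h (interior_subset h'))
  rw [this] at h
  exact h hp

/-- The self-map of the sphere induced by a homeomorphism supported in the open cylinder. -/
noncomputable def sphereMap (H : (ℝ × ℂ) ≃ₜ (ℝ × ℂ))
    (hH : ∀ p, p ∉ interior cylinder → H p = p) (p : S3) : S3 :=
  toSphere ⟨H (Function.surjInv toSphere_surjective p).1,
    mem_cylinder_of_fix hH (Function.surjInv toSphere_surjective p).2⟩

theorem sphereMap_toSphere (H : (ℝ × ℂ) ≃ₜ (ℝ × ℂ))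
    (hH : ∀ p, p ∉ interior cylinder → H p = p) (a : cylinder) :
    sphereMap H hH (toSphere a) = toSphere ⟨H a, mem_cylinder_of_fix hH a.2⟩ := by
  have e : toSphere (Function.surjInv toSphere_surjective (toSphere a)) = toSphere a :=
    Function.surjInv_eq _ _
  set b := Function.surjInv toSphere_surjective (toSphere a)
  have e' : closureMap b = closureMap a := congrArg Subtype.val e
  refine Subtype.ext ?_
  show closureMap (H b) = closureMap (H a)
  rcases eq_or_notMem_of_closureMap_eq b.2 a.2 e' with h | ⟨h, h'⟩
  · rw [h]
  · rw [hH _ h, hH _ h', e']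

/-- A continuous surjection from a compact space to a Hausdorff space is a quotient map, so
continuity can be tested on the cylinder. -/
theorem continuous_sphereMap (H : (ℝ × ℂ) ≃ₜ (ℝ × ℂ))
    (hH : ∀ p, p ∉ interior cylinder → H p = p) : Continuous (sphereMap H hH) := by
  have : CompactSpace cylinder := isCompact_iff_compactSpace.1 isCompact_cylinder
  have hq : Topology.IsQuotientMap toSphere :=
    continuous_toSphere.isClosedMap.isQuotientMap continuous_toSphere toSphere_surjective
  rw [hq.continuous_iff, show sphereMap H hH ∘ toSphere =
    fun a : cylinder => toSphere ⟨H a, mem_cylinder_of_fix hH a.2⟩ from funext (sphereMap_toSphere H hH)]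
  exact continuous_toSphere.comp ((H.continuous.comp continuous_subtype_val).subtype_mk _)

/-- Equivalent tangles have equivalent closures. -/
theorem AmbientEquiv.tangleClosure {A B : Set (ℝ × ℂ)} (h : AmbientEquiv A B)
    (hA : A ⊆ cylinder) : ∃ g : S3 ≃ₜ S3, g '' tangleClosure A = tangleClosure B := by
  obtain ⟨H, hH, rfl⟩ := h
  have hH' : ∀ p, p ∉ interior cylinder → H.symm p = p := fun p hp => by
    rw [Homeomorph.symm_apply_eq, hH p hp]
  refine ⟨⟨⟨sphereMap H hH, sphereMap H.symm hH', fun p => ?_, fun p => ?_⟩,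
    continuous_sphereMap H hH, continuous_sphereMap H.symm hH'⟩, ?_⟩
  · obtain ⟨a, rfl⟩ := toSphere_surjective p
    simp [sphereMap_toSphere]
  · obtain ⟨a, rfl⟩ := toSphere_surjective p
    simp [sphereMap_toSphere]
  · ext p
    constructor
    · rintro ⟨p, ⟨a, ha, e⟩, rfl⟩
      have : p = toSphere ⟨a, hA ha⟩ := Subtype.ext e
      refine ⟨H a, ⟨a, ha, rfl⟩, ?_⟩
      show (sphereMap H hH p).1 = _
      rw [this, sphereMap_toSphere]
      rfl
    · rintro ⟨_, ⟨a, ha, rfl⟩, e⟩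
      refine ⟨toSphere ⟨a, hA ha⟩, ⟨a, ha, rfl⟩, ?_⟩
      show sphereMap H hH _ = p
      rw [sphereMap_toSphere]
      exact Subtype.ext e.symm

/-! ### Rotations of the sphere. -/

theorem exp_real_add (x y : ℝ) : Complex.exp ((x + y : ℝ) * Complex.I) =
    Complex.exp (x * Complex.I) * Complex.exp (y * Complex.I) := by
  rw [← Complex.exp_add]; push_cast; ring_nf

/-- The rotation `(z₁, z₂) ↦ (e^{iα} z₁, e^{iβ} z₂)` of the sphere. -/
noncomputable def torusRotation (α β : ℝ) : S3 ≃ₜ S3 where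
  toFun p := ⟨(Complex.exp (α * Complex.I) * p.1.1, Complex.exp (β * Complex.I) * p.1.2), by
    simpa [Complex.norm_exp_ofReal_mul_I] using p.2⟩
  invFun p := ⟨(Complex.exp ((-α : ℝ) * Complex.I) * p.1.1,
    Complex.exp ((-β : ℝ) * Complex.I) * p.1.2), by
    simpa only [norm_mul, Complex.norm_exp_ofReal_mul_I, one_mul] using p.2⟩
  left_inv p := by
    refine Subtype.ext (Prod.ext ?_ ?_) <;> simp only <;>
      rw [← mul_assoc, ← exp_real_add] <;> simp
  right_inv p := by
    refine Subtype.ext (Prod.ext ?_ ?_) <;> simp only <;>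
      rw [← mul_assoc, ← exp_real_add] <;> simp
  continuous_toFun := by fun_prop
  continuous_invFun := by fun_prop

theorem torusRotation_apply (α β : ℝ) (p : S3) : (torusRotation α β p).1 =
    (Complex.exp (α * Complex.I) * p.1.1, Complex.exp (β * Complex.I) * p.1.2) := rfl

theorem torusRotation_pow (α β : ℝ) (n : ℕ) :
    torusRotation α β ^ n = torusRotation (n * α) (n * β) := by
  induction n with
  | zero => ext p <;> simp [torusRotation_apply]
  | succ n ih =>
    rw [pow_succ', ih]
    ext p <;>
    · simp only [Homeomorph.mul_apply, torusRotation_apply]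
      rw [← mul_assoc, ← exp_real_add]
      congr 4
      push_cast
      ring

theorem exp_eq_one_iff_dvd {q : ℕ} (hq : 0 < q) (n : ℤ) :
    Complex.exp ((n * (2 * Real.pi / q) : ℝ) * Complex.I) = 1 ↔ (q : ℤ) ∣ n := by
  have hq' : (q : ℂ) ≠ 0 := by exact_mod_cast hq.ne'
  have hpi := Complex.two_pi_I_ne_zero
  rw [Complex.exp_eq_one_iff]
  refine exists_congr fun k => ?_
  have e : (((n * (2 * Real.pi / q) : ℝ) : ℂ) * Complex.I = k * (2 * Real.pi * Complex.I)) ↔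
      (n : ℂ) = q * k := by
    push_cast
    rw [show (n : ℂ) * (2 * Real.pi / q) * Complex.I = (n / q) * (2 * Real.pi * Complex.I) by ring,
      mul_left_inj' hpi, div_eq_iff hq', mul_comm]
  rw [e]
  exact_mod_cast Iff.rfl

theorem orderOf_torusRotation {q : ℕ} (hq : 0 < q) (b : ℤ) :
    orderOf (torusRotation (2 * Real.pi / q) (b * (2 * Real.pi / q))) = q := by
  refine (orderOf_eq_iff hq).2 ⟨?_, fun m hm hm0 h => ?_⟩
  · have h1 := (exp_eq_one_iff_dvd hq q).2 dvd_rfl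
    have h2 := (exp_eq_one_iff_dvd hq (q * b)).2 (dvd_mul_right _ _)
    push_cast at h1 h2
    rw [torusRotation_pow]
    ext p
    · rw [torusRotation_apply]
      push_cast
      simp [h1]
    · rw [torusRotation_apply]
      push_cast
      simp [← mul_assoc, h2]
  -- The orbit of (1, 0) already detects the order.
  · have := congrArg (fun Φ : S3 ≃ₜ S3 => (Φ ⟨(1, 0), by simp⟩).1.1) h
    simp only [torusRotation_pow, torusRotation_apply, Homeomorph.one_apply, mul_one] at this
    have hd := (exp_eq_one_iff_dvd hq m).1 (by exact_mod_cast this)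
    exact absurd (Nat.le_of_dvd hm0 (by exact_mod_cast hd)) (by omega)

/-- A fixed point with z₁ ≠ 0 would force q ∣ m; on the circle z₁ = 0 it would force q ∣ mb, and
hence q ∣ m by coprimality. -/
theorem torusRotation_pow_ne {q : ℕ} {b : ℤ} (hb : IsCoprime (q : ℤ) b) {m : ℕ}
    (h1 : 1 ≤ m) (hm : m < q) (p : S3) :
    (torusRotation (2 * Real.pi / q) (b * (2 * Real.pi / q)) ^ m) p ≠ p := by
  intro h
  have hq : 0 < q := by omega
  have hnd : ¬ (q : ℤ) ∣ m := fun hd =>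
    absurd (Nat.le_of_dvd h1 (by exact_mod_cast hd)) (by omega)
  have h' := congrArg Subtype.val h
  rw [torusRotation_pow, torusRotation_apply] at h'
  have h2 := congrArg Prod.fst h'
  have h3 := congrArg Prod.snd h'
  simp only at h2 h3
  rw [← mul_assoc] at h3
  have e2 := (exp_eq_one_iff_dvd hq m)
  have e3 := (exp_eq_one_iff_dvd hq (m * b))
  push_cast at e2 e3
  by_cases hp : p.1.1 = 0
  · have hp2 : p.1.2 ≠ 0 := fun h0 => by simpa [hp, h0] using p.2
    exact hnd (hb.dvd_of_dvd_mul_right (e3.1 (by simpa using mul_right_cancel₀ hp2 (h3.trans (one_mul _).symm))))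
  · exact hnd (e2.1 (by simpa using mul_right_cancel₀ hp (h2.trans (one_mul _).symm)))

/-! ### Redistributing the twist. -/

/-- The tangle turned by `k` half turns about the axis. -/
noncomputable def halfTurns (k : ℤ) (T : Set (ℝ × ℂ)) : Set (ℝ × ℂ) :=
  {p | (p.1, Complex.exp ((-(Real.pi * k) : ℝ) * Complex.I) * p.2) ∈ T}

theorem exp_pi_mul_int (k : ℤ) : Complex.exp ((Real.pi * k : ℝ) * Complex.I) = 1 ∨
    Complex.exp ((Real.pi * k : ℝ) * Complex.I) = -1 := by
  have : Complex.exp ((Real.pi * k : ℝ) * Complex.I) = (-1) ^ k := by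
    rw [← Complex.exp_pi_mul_I, ← Complex.exp_int_mul]
    push_cast
    ring_nf
  rw [this]
  rcases Int.even_or_odd k with h | h
  · exact Or.inl h.neg_one_zpow
  · exact Or.inr h.neg_one_zpow

/-- Only the parity of `k` matters: the result is `T` or its half turn. -/
theorem ambientEquiv_halfTurns {T : Set (ℝ × ℂ)} (h : AmbientEquiv T (halfTurn T)) (k : ℤ) :
    AmbientEquiv T (halfTurns k T) := by
  have e := exp_pi_mul_int (-k)
  rw [Int.cast_neg, mul_neg] at e
  rcases e with e | e
  · convert AmbientEquiv.refl T using 1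
    ext p
    rw [halfTurns, mem_ofPred_eq, e]
    simp
  · convert h using 1
    ext ⟨x, v⟩
    rw [mem_halfTurn]
    rw [halfTurns, mem_ofPred_eq, e]
    simp

theorem halfTurns_subset (k : ℤ) {T : Set (ℝ × ℂ)} {r : ℝ}
    (h : T ⊆ Icc 0 1 ×ˢ Metric.closedBall 0 r) :
    halfTurns k T ⊆ Icc 0 1 ×ˢ Metric.closedBall 0 r := by
  rintro ⟨x, v⟩ hp
  obtain ⟨h1, h2⟩ := h hp
  refine ⟨h1, ?_⟩
  rw [mem_closedBall_zero_iff] at h2 ⊢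
  rwa [norm_mul, Complex.norm_exp_ofReal_mul_I, one_mul] at h2

/-- The angle that grows by `c l` over the first half of the `l`-th slot. -/
noncomputable def twistAngle {q : ℕ} (c : Fin q → ℝ) (x : ℝ) : ℝ :=
  ∑ l, c l * ramp (2 * (q * x - l))

theorem continuous_twistAngle {q : ℕ} (c : Fin q → ℝ) : Continuous (twistAngle c) := by
  have := continuous_ramp
  unfold twistAngle
  fun_prop

theorem twistAngle_of_le {q : ℕ} (c : Fin q → ℝ) {x : ℝ} (hx : x ≤ 0) : twistAngle c x = 0 := by
  refine Finset.sum_eq_zero fun l _ => ?_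
  have : (q : ℝ) * x ≤ 0 := mul_nonpos_of_nonneg_of_nonpos (by positivity) hx
  have : (0 : ℝ) ≤ l := by positivity
  rw [ramp_eq_zero (by linarith), mul_zero]

theorem twistAngle_of_ge {q : ℕ} (c : Fin q → ℝ) {x : ℝ} (hx : 1 ≤ x) :
    twistAngle c x = ∑ l, c l := by
  refine Finset.sum_congr rfl fun l _ => ?_
  have : (q : ℝ) ≤ q * x := le_mul_of_one_le_right (by positivity) hx
  have : (l : ℝ) + 1 ≤ q := by exact_mod_cast l.isLt
  rw [ramp_eq_one (by linarith), mul_one]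

theorem twistAngle_slot {q : ℕ} (c : Fin q → ℝ) (j : Fin q) {u : ℝ} (hu : u ∈ Icc (0 : ℝ) 1) :
    twistAngle c ((j + u) / q) = ∑ l ∈ Finset.Iio j, c l + c j * ramp (2 * u) := by
  have hq : (q : ℝ) ≠ 0 := by exact_mod_cast j.pos.ne'
  have h1 := hu.1
  have h2 := hu.2
  rw [twistAngle, mul_div_cancel₀ _ hq]
  rw [← Finset.sum_subset (Finset.subset_univ (Finset.Iic j)), ← Finset.Iio_insert,
    Finset.sum_insert (by simp), add_comm]
  · congr 1
    · refine Finset.sum_congr rfl fun l hl => ?_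
      have : (l : ℝ) + 1 ≤ j := by exact_mod_cast Finset.mem_Iio.1 hl
      rw [ramp_eq_one (by linarith), mul_one]
    · ring_nf
  · intro l _ hl
    have : (j : ℝ) + 1 ≤ l := by
      have := not_le.1 (fun h => hl (Finset.mem_Iic.2 h))
      exact_mod_cast this
    rw [ramp_eq_zero (by linarith), mul_zero]

/-- A twist by the angle `β`, followed by `T` turned by the angle `α`. -/
noncomputable def twistBlock (β α : ℝ) (T : Set (ℝ × ℂ)) : Set (ℝ × ℂ) :=
  {p | (2 * p.1 ∈ Icc (0 : ℝ) 1 ∧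
      OnStrands (Complex.exp ((β * ramp (2 * p.1) : ℝ) * Complex.I)) p.2) ∨
    (2 * p.1 - 1, Complex.exp ((-α : ℝ) * Complex.I) * p.2) ∈ T}

theorem twistBlock_fst_mem {β α : ℝ} {T : Set (ℝ × ℂ)} {D : Set ℂ} (hT : T ⊆ Icc 0 1 ×ˢ D)
    {p : ℝ × ℂ} (hp : p ∈ twistBlock β α T) : p.1 ∈ Icc (0 : ℝ) 1 := by
  rcases hp with h | h
  · exact ⟨by linarith [h.1.1], by linarith [h.1.2]⟩
  · have := (hT h).1
    simp only [mem_Icc] at this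
    exact ⟨by linarith, by linarith⟩

/-- On the braid half, the leftover half turns `m` disappear because the strands are antipodal. On
the tangle half, the ramp is 1 and the angles combine to exactly `k` half turns. -/
theorem mem_tangleSum_iff_twistBlock {n k m : ℤ} {T : Set (ℝ × ℂ)} (hT : T ⊆ Icc 0 1 ×ˢ univ)
    {β α φ u : ℝ} (v : ℂ) (hφ : φ = -(Real.pi * m) + (β - Real.pi * n) * ramp (2 * u))
    (hk : α - β = Real.pi * (k - m - n)) :
    (u, v) ∈ tangleSum ![braidPow n, halfTurns k T] ↔
      (u, Complex.exp (φ * Complex.I) * v) ∈ twistBlock β α T := by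
  rw [mem_tangleSum_two, mem_braidPow]
  refine or_congr (and_congr_right fun hu => ?_) ?_
  · have e : Complex.exp ((β * ramp (2 * u) : ℝ) * Complex.I) =
        Complex.exp (φ * Complex.I) * (Complex.exp ((Real.pi * m : ℝ) * Complex.I) *
          Complex.exp ((Real.pi * n * ramp (2 * u) : ℝ) * Complex.I)) := by
      rw [← exp_real_add, ← exp_real_add, hφ]
      congr 3
      ring
    simp only
    rw [e, onStrands_mul (Complex.exp_ne_zero _)]
    rcases exp_pi_mul_int m with h | h
    · rw [h, one_mul]
    · rw [h, neg_one_mul, onStrands_neg_left]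
  · show (_, _) ∈ T ↔ (_, _) ∈ T
    by_cases hu : 0 ≤ 2 * u - 1
    · simp only
      rw [← mul_assoc, ← exp_real_add, hφ, ramp_eq_one (by linarith),
        show -α + (-(Real.pi * m) + (β - Real.pi * n) * 1) = -(Real.pi * k) by linear_combination -hk]
    · exact iff_of_false (fun h => hu (hT h).1.1) (fun h => hu (hT h).1.1)

theorem closureMap_shift (α x : ℝ) (δ : ℝ) (v : ℂ) :
    closureMap (x + δ, Complex.exp (α * Complex.I) * v) =
      (Complex.exp ((2 * Real.pi * δ : ℝ) * Complex.I) * (closureMap (x, v)).1,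
        Complex.exp (α * Complex.I) * (closureMap (x, v)).2) := by
  refine Prod.ext ?_ rfl
  simp only [closureMap, norm_mul, Complex.norm_exp_ofReal_mul_I, one_mul]
  rw [mul_left_comm, ← Complex.exp_add]
  push_cast
  ring_nf

/-! ### The rotation-invariant model. -/

/-- The union in the sphere of the `q` images of a block by the powers of a rotation. -/
noncomputable def rotatedBlocks (q : ℕ) (b : ℤ) (A : Set (ℝ × ℂ)) : Set S3 :=
  {p | ∃ n : ℤ, ∃ a ∈ A, p.1 = closureMap ((n + a.1) / q,
    Complex.exp ((n * (b * (2 * Real.pi / q)) : ℝ) * Complex.I) * a.2)}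

/-- Since the blocks are indexed by all integers, the rotation is just a shift of the index, with no
wrap-around. -/
theorem torusRotation_mem_rotatedBlocks {q : ℕ} {b : ℤ} {A : Set (ℝ × ℂ)} {p : S3} :
    torusRotation (2 * Real.pi / q) (b * (2 * Real.pi / q)) p ∈ rotatedBlocks q b A ↔
      p ∈ rotatedBlocks q b A := by
  have key : ∀ (n : ℤ) (a : ℝ × ℂ),
      (torusRotation (2 * Real.pi / q) (b * (2 * Real.pi / q)) p).1 =
        closureMap (((n + 1 : ℤ) + a.1) / q,
          Complex.exp (((n + 1 : ℤ) * (b * (2 * Real.pi / q)) : ℝ) * Complex.I) * a.2) ↔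
      p.1 = closureMap ((n + a.1) / q,
        Complex.exp ((n * (b * (2 * Real.pi / q)) : ℝ) * Complex.I) * a.2) := by
    intro n a
    rw [show (((n + 1 : ℤ) : ℝ) + a.1) / q = (n + a.1) / q + 1 / q by push_cast; ring,
      show ((n + 1 : ℤ) : ℝ) * (b * (2 * Real.pi / q)) =
        b * (2 * Real.pi / q) + n * (b * (2 * Real.pi / q)) by push_cast; ring,
      exp_real_add, mul_assoc, closureMap_shift, torusRotation_apply, mul_one_div, Prod.mk.injEq,
      mul_right_inj' (Complex.exp_ne_zero _), mul_right_inj' (Complex.exp_ne_zero _), Prod.ext_iff]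
  constructor
  · rintro ⟨n, a, ha, e⟩
    exact ⟨n - 1, a, ha, (key _ a).1 (by rwa [sub_add_cancel])⟩
  · rintro ⟨n, a, ha, e⟩
    exact ⟨n + 1, a, ha, (key _ a).2 e⟩

/-- Changing the index by a multiple of q adds full turns to both angles, because `b` is an integer.
-/
theorem exists_fin_of_mem_rotatedBlocks {q : ℕ} (hq : 0 < q) {b : ℤ} {A : Set (ℝ × ℂ)} {p : S3}
    (hp : p ∈ rotatedBlocks q b A) : ∃ j : Fin q, ∃ a ∈ A, p.1 = closureMap ((j + a.1) / q,
      Complex.exp ((j * (b * (2 * Real.pi / q)) : ℝ) * Complex.I) * a.2) := by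
  obtain ⟨n, a, ha, e⟩ := hp
  have hq' : (0 : ℤ) < q := by exact_mod_cast hq
  have hqr : (q : ℝ) ≠ 0 := by exact_mod_cast hq.ne'
  obtain ⟨j, hj⟩ := Int.eq_ofNat_of_zero_le (Int.emod_nonneg n hq'.ne')
  have hjq : j < q := by
    have := Int.emod_lt_of_pos n hq'
    omega
  refine ⟨⟨j, hjq⟩, a, ha, e.trans ?_⟩
  have hn : (n : ℝ) = j + q * (n / q : ℤ) := by
    have := Int.emod_add_mul_ediv n q
    rw [hj] at this
    exact_mod_cast this.symm
  set t : ℤ := n / q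
  have hx : ((n : ℝ) + a.1) / q = (j + a.1) / q + t := by rw [hn]; field_simp; ring
  have hv : Complex.exp ((n * (b * (2 * Real.pi / q)) : ℝ) * Complex.I) =
      Complex.exp ((j * (b * (2 * Real.pi / q)) : ℝ) * Complex.I) := by
    have h1 := (exp_eq_one_iff_dvd hq (q * (t * b))).2 (dvd_mul_right _ _)
    rw [show (n : ℝ) * (b * (2 * Real.pi / q)) = j * (b * (2 * Real.pi / q)) +
      ((q * (t * b) : ℤ) : ℝ) * (2 * Real.pi / q) by rw [hn]; push_cast; ring, exp_real_add, h1,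
      mul_one]
  have := closureMap_shift 0 ((j + a.1) / q) t
    (Complex.exp ((j * (b * (2 * Real.pi / q)) : ℝ) * Complex.I) * a.2)
  have ht : Complex.exp ((2 * Real.pi * t : ℝ) * Complex.I) = 1 := by
    rw [Complex.exp_eq_one_iff]
    exact ⟨t, by push_cast; ring⟩
  rw [ht] at this
  simp only [Complex.ofReal_zero, zero_mul, Complex.exp_zero, one_mul] at this
  rw [hx, hv, this]

/-- The closure of `σ^{i₁} T ⋯ σ^{i_q} T` is equivalent to a union of `q` blocks that are permuted
by a rotation of the sphere. -/
theorem exists_homeomorph_rotatedBlocks {q : ℕ} (hq : 0 < q) (i : Fin q → ℤ) {T : Set (ℝ × ℂ)}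
    (hT : IsTangle T) (hsymm : IsSymmetric T) {b t : ℤ} (hb : 2 * b = ∑ j, i j + q * t) :
    ∃ (g : S3 ≃ₜ S3) (A : Set (ℝ × ℂ)), (∀ a ∈ A, ‖a.2‖ < 1) ∧
      g '' virtuallyVisibleClosure i T = rotatedBlocks q b A := by
  obtain ⟨r, hr, hr1, hTr⟩ := hT.exists_radius
  have hT1 : T ⊆ Icc 0 1 ×ˢ univ := hTr.trans (prod_mono_right (subset_univ _))
  have hqr : (q : ℝ) ≠ 0 := by exact_mod_cast hq.ne'
  set w : ℤ := ∑ j, i j with hw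
  set β : ℝ := Real.pi * w / q with hβ
  set α : ℝ := b * (2 * Real.pi / q) with hα
  have hαβ : α = β + Real.pi * t := by
    have : (2 : ℝ) * b = w + q * t := by exact_mod_cast hb
    rw [hα, hβ]
    field_simp
    linear_combination this
  -- The twist missing in each block. These corrections sum to 0, so the correcting turn is trivial
  -- at both ends.
  set c : Fin q → ℝ := fun l => β - Real.pi * i l with hc
  have hc0 : ∑ l, c l = 0 := by
    have : ∑ l, (i l : ℝ) = w := by rw [hw]; push_cast; rfl
    simp only [hc, Finset.sum_sub_distrib, ← Finset.mul_sum, this, Finset.sum_const,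
      Finset.card_univ, Fintype.card_fin, nsmul_eq_mul, hβ]
    field_simp
    ring
  set s : Fin q → ℤ := fun j => ∑ l ∈ Finset.Iio j, i l with hs
  -- Chosen so that, after the correcting turn, the copy of `T` in slot `j` is turned by exactly (j
  -- + 1)α.
  set k : Fin q → ℤ := fun j => s j + i j + (j + 1) * t with hk
  set N : Set (ℝ × ℂ) := tangleSum fun j => tangleSum ![braidPow (i j), halfTurns (k j) T] with hN
  set A : Set (ℝ × ℂ) := twistBlock β α T
  have hNr : N ⊆ Icc 0 1 ×ˢ Metric.closedBall 0 r := tangleSum_subset fun j =>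
    tangleSum_two_subset (braidPow_subset _ hr) (halfTurns_subset _ hTr)
  have hVr : (tangleSum fun j => tangleSum ![braidPow (i j), T]) ⊆
      Icc 0 1 ×ˢ Metric.closedBall 0 r := tangleSum_subset fun j =>
    tangleSum_two_subset (braidPow_subset _ hr) hTr
  have hbr : ∀ n, braidPow n ⊆ Icc 0 1 ×ˢ univ := fun n =>
    (braidPow_subset n hr).trans (prod_mono_right (subset_univ _))
  have hkT : ∀ n, halfTurns n T ⊆ Icc 0 1 ×ˢ univ := fun n =>
    (halfTurns_subset n hTr).trans (prod_mono_right (subset_univ _))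
  have hVN : AmbientEquiv (tangleSum fun j => tangleSum ![braidPow (i j), T]) N := by
    refine AmbientEquiv.tangleSum (fun j => tangleSum_two_subset (hbr _) hT1)
      (fun j => tangleSum_two_subset (hbr _) (hkT _)) fun j => AmbientEquiv.tangleSum ?_ ?_ ?_
    · exact fun l => by fin_cases l <;> [exact hbr _; exact hT1]
    · exact fun l => by fin_cases l <;> [exact hbr _; exact hkT _]
    · exact fun l => by
        fin_cases l <;> [exact .refl _; exact ambientEquiv_halfTurns hsymm.ambientEquiv _]
  set θ := twistAngle c with hθ
  set tw : ℝ × ℂ → ℝ × ℂ := fun p => (p.1, Complex.exp (θ p.1 * Complex.I) * p.2) with htw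
  have hNM : AmbientEquiv N (tw '' N) := by
    refine AmbientEquiv.of_slices hr1 ?_ hNr continuous_id strictMono_id (fun _ _ => rfl)
      (continuous_twistAngle c) ?_ fun y _ v => ⟨fun h => ⟨_, h, rfl⟩, ?_⟩
    · rintro _ ⟨⟨x, v⟩, hp, rfl⟩
      refine ⟨(hNr hp).1, ?_⟩
      have := (hNr hp).2
      rw [mem_closedBall_zero_iff] at this ⊢
      simpa only [htw, norm_mul, Complex.norm_exp_ofReal_mul_I, one_mul] using this
    · rintro y (h | h)
      · exact twistAngle_of_le c h
      · rw [twistAngle_of_ge c h, hc0]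
    · rintro ⟨⟨x, v'⟩, hp, e⟩
      simp only [htw, Prod.mk.injEq, id] at e
      obtain ⟨rfl, e⟩ := e
      rwa [mul_left_cancel₀ (Complex.exp_ne_zero _) e] at hp
  -- After the correction, and after turning back by jα, slot `j` becomes the same block `A` for
  -- every `j`.
  have hslot : ∀ (j : Fin q) (u : ℝ) (v : ℂ), u ∈ Icc (0 : ℝ) 1 →
      ((u, v) ∈ tangleSum ![braidPow (i j), halfTurns (k j) T] ↔
        (u, Complex.exp ((-(j * α) + θ ((j + u) / q) : ℝ) * Complex.I) * v) ∈ A) := by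
    intro j u v hu
    refine mem_tangleSum_iff_twistBlock (m := s j + j * t) hT1 v ?_ ?_
    · have h1 : ∑ l ∈ Finset.Iio j, (i l : ℝ) = s j := by simp only [hs]; push_cast; rfl
      rw [hθ, twistAngle_slot c j hu]
      simp only [hc, Finset.sum_sub_distrib, ← Finset.mul_sum, h1, Finset.sum_const,
        Fin.card_Iio, nsmul_eq_mul]
      rw [hαβ]
      push_cast
      ring
    · rw [hαβ]
      simp only [hk]
      push_cast
      ring
  obtain ⟨g, hg⟩ := (hVN.trans hNM).tangleClosure
    (hVr.trans (prod_mono_right (Metric.closedBall_subset_closedBall hr1.le)))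
  refine ⟨g, A, ?_, hg.trans ?_⟩
  · rintro ⟨u, v⟩ (h | h)
    · have := h.2.norm
      rw [Complex.norm_exp_ofReal_mul_I] at this
      rw [this]; norm_num
    · have := (hTr h).2
      rw [mem_closedBall_zero_iff, norm_mul, Complex.norm_exp_ofReal_mul_I, one_mul] at this
      exact this.trans_lt hr1
  · have hexp : ∀ (j : Fin q) (x : ℝ) (v : ℂ), Complex.exp ((j * α : ℝ) * Complex.I) *
        (Complex.exp ((-(j * α) + x : ℝ) * Complex.I) * v) = Complex.exp (x * Complex.I) * v := by
      intro j x v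
      rw [← mul_assoc, ← exp_real_add, add_neg_cancel_left]
    ext p
    constructor
    · rintro ⟨_, ⟨_, ⟨j, ⟨u, v⟩, ha, rfl⟩, rfl⟩, e⟩
      have hu : u ∈ Icc (0 : ℝ) 1 := (tangleSum_two_subset (hbr _) (hkT _) ha).1
      refine ⟨j, _, (hslot j u v hu).1 ha, e.trans ?_⟩
      simp only [htw, Int.cast_natCast]
      rw [hexp]
      rfl
    · intro hp
      obtain ⟨j, ⟨u, v⟩, ha, e⟩ := exists_fin_of_mem_rotatedBlocks hq hp
      have hu : u ∈ Icc (0 : ℝ) 1 := twistBlock_fst_mem hT1 ha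
      set φ : ℝ := -(j * α) + θ ((j + u) / q) with hφ
      -- Writing `v` as a point turned by `φ` lets `hslot` be read backwards.
      have hv : v = Complex.exp (φ * Complex.I) * (Complex.exp ((-φ : ℝ) * Complex.I) * v) := by
        rw [← mul_assoc, ← exp_real_add, add_neg_cancel]
        simp
      rw [hv] at ha e
      refine ⟨_, ⟨_, ⟨j, _, (hslot j u _ hu).2 ha, rfl⟩, rfl⟩, e.trans ?_⟩
      simp only [htw]
      rw [hφ, hexp]
      rfl

end KnotPeriod

/-! ### The two cases of the proposition. -/

theorem proposition5p9 (q : ℕ) (hq : 3 ≤ q) (hodd : Odd q) (i : Fin q → ℤ)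
    (T : Set (ℝ × ℂ)) (hT : KnotPeriod.IsTangle T) (hsymm : KnotPeriod.IsSymmetric T)
    (K : Set KnotPeriod.S3) (hK : KnotPeriod.IsKnot K)
    (hKT : ∃ g : KnotPeriod.S3 ≃ₜ KnotPeriod.S3,
      g '' K = KnotPeriod.virtuallyVisibleClosure i T) :
    ((q : ℤ) ∣ ∑ j, i j → KnotPeriod.IsPeriodic q K) ∧
    (Int.gcd (∑ j, i j) q = 1 → KnotPeriod.IsFreelyPeriodic q K) := by
  have hq0 : 0 < q := by omega
  obtain ⟨g, hg⟩ := hKT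
  have key : ∀ b t : ℤ, 2 * b = ∑ j, i j + q * t →
      ∃ (c : KnotPeriod.S3 ≃ₜ KnotPeriod.S3), (∀ p ∈ K, (c p).1.1 ≠ 0) ∧
        (c⁻¹ * KnotPeriod.torusRotation (2 * Real.pi / q) (b * (2 * Real.pi / q)) * c) '' K = K ∧
        orderOf (c⁻¹ * KnotPeriod.torusRotation (2 * Real.pi / q) (b * (2 * Real.pi / q)) * c)
          = q := by
    intro b t hbt
    obtain ⟨g', A, hA, hg'⟩ := KnotPeriod.exists_homeomorph_rotatedBlocks hq0 i hT hsymm hbt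
    have hK' : ∀ p, p ∈ K ↔ (g' * g) p ∈ KnotPeriod.rotatedBlocks q b A := by
      intro p
      rw [← hg', ← hg, ← Set.image_comp]
      exact ((g' * g).injective.mem_set_image (s := K)).symm
    refine ⟨g' * g, ?_, ?_⟩
    -- On the axis z₁ = 0 one has |z₂| = 1, whereas the blocks stay strictly inside the unit disk.
    · intro p hp h0
      obtain ⟨n, a, ha, e⟩ := (hK' p).1 hp
      have h1 := congrArg Prod.snd e
      have h2 := ((g' * g) p).2
      rw [h0, h1] at h2
      have h3 := hA a ha
      simp only [KnotPeriod.closureMap, norm_mul, Complex.norm_exp_ofReal_mul_I, one_mul, norm_zero]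
        at h2
      nlinarith [norm_nonneg a.2]
    · generalize g' * g = c at hK'
      refine ⟨?_, ?_⟩
      · set Ψ := KnotPeriod.torusRotation (2 * Real.pi / q) (b * (2 * Real.pi / q)) with hΨ
        have hmem : ∀ p, (c⁻¹ * Ψ * c) p ∈ K ↔ p ∈ K := by
          intro p
          rw [hK', hK', ← Homeomorph.mul_apply, mul_assoc, mul_inv_cancel_left,
            Homeomorph.mul_apply, hΨ, KnotPeriod.torusRotation_mem_rotatedBlocks]
        ext p
        constructor
        · rintro ⟨p, hp, rfl⟩
          exact (hmem p).2 hp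
        · intro hp
          obtain ⟨p, rfl⟩ := (c⁻¹ * Ψ * c).surjective p
          exact ⟨p, (hmem p).1 hp, rfl⟩
      · have := (MulAut.conj c⁻¹).orderOf_eq
          (KnotPeriod.torusRotation (2 * Real.pi / q) (b * (2 * Real.pi / q)))
        rwa [MulAut.conj_apply, inv_inv, KnotPeriod.orderOf_torusRotation hq0] at this
  constructor
  · rintro ⟨m, hm⟩
    -- With b = 0 the second coordinate is fixed.
    obtain ⟨c, hc, h1, h2⟩ := key 0 (-m) (by rw [hm]; ring)
    refine ⟨_, h1, h2, c, fun p => ?_, hc⟩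
    rw [← Homeomorph.mul_apply, mul_assoc, mul_inv_cancel_left, Homeomorph.mul_apply,
      KnotPeriod.torusRotation_apply]
    refine Prod.ext ?_ ?_
    · simp only
      congr 2
      push_cast
      ring
    · simp
  · intro hw
    obtain ⟨m, hm⟩ := hodd
    have hm' : (q : ℤ) = 2 * m + 1 := by exact_mod_cast hm
    -- For q = 2m + 1, the number m + 1 is the inverse of 2 modulo q, so b = w(m + 1) satisfies 2b =
    -- w + qw.
    obtain ⟨c, -, h1, h2⟩ := key ((∑ j, i j) * (m + 1)) (∑ j, i j) (by linear_combination (-(∑ j, i j)) * hm')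
    refine ⟨_, h1, h2, fun n hn hnq p hp => ?_⟩
    have hcop : IsCoprime (q : ℤ) ((∑ j, i j) * (m + 1)) := by
      refine IsCoprime.mul_right (Int.isCoprime_iff_gcd_eq_one.2 hw).symm ⟨-1, 2, ?_⟩
      linear_combination -hm'
    have e := conj_pow (i := n) (a := c⁻¹)
      (b := KnotPeriod.torusRotation (2 * Real.pi / q) (((∑ j, i j) * (m + 1) : ℤ) * (2 * Real.pi / q)))
    rw [inv_inv] at e
    rw [e] at hp
    refine KnotPeriod.torusRotation_pow_ne hcop hn hnq (c p) ?_
    have := congrArg c hp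
    rwa [← Homeomorph.mul_apply, mul_assoc, mul_inv_cancel_left, Homeomorph.mul_apply] at this
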